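/- Let $|\Phi^{\pm}\rangle=(|00\rangle\pm|11\rangle)/\sqrt2$ and, for $\alpha\in[0,1]$, let $\Omega_\alpha=\frac{1+\alpha}{2}|\Phi^+\rangle\langle\Phi^+|+\frac{1-\alpha}{2}|\Phi^-\rangle\langle\Phi^-|$, a state of two qubits, one held by Alice and one by Bob. The fully entangled fraction of a two-qubit state $\rho$ is $$F(\rho)=\max_{U_A,U_B}\langle\Phi^+|(U_A\otimes U_B)\,\rho\,(U_A\otimes U_B)^\dagger|\Phi^+\rangle,$$ the maximum being over single-qubit unitaries $U_A,U_B$. A (probabilistic) non-interactive entanglement-distillation protocol $\mathcal E$ on $n$ shared qubit pairs works as follows. With probabilities $p_1,\dots,p_m$ ($p_\ell\ge 0$, $\sum_\ell p_\ell=1$) a value $\ell$ of the shared randomness is chosen. For each $\ell$, Alice and Bob add finitely many local ancilla qubits in states $\tau_A^\ell$ and $\tau_B^\ell$, apply local unitaries $U_A^\ell$ and $U_B^\ell$ to their $n$ qubits and ancillas, and each trace out everything but a single qubit. There is no communication and no post-selection, so the output is the two-qubit state $$\mathcal E(R)=\sum_{\ell=1}^m p_\ell\,\mathrm{Tr}_{\bar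 A\bar B}\!\left[(U_A^\ell\otimes U_B^\ell)(R\otimes\tau_A^\ell\otimes\tau_B^\ell)(U_A^\ell\otimes U_B^\ell)^\dagger\right].$$ Theorem. For every $\alpha\in[0,1]$, every $n\ge 0$ and every such protocol $\mathcal E$ on $n$ pairs, $$F\big(\mathcal E(\Omega_\alpha^{\otimes n})\big)\le\frac{1+\alpha}{2}.$$ The bound is tight: for every $\alpha\in[0,1]$ and every $n\ge1$ there is such a protocol $\mathcal E$ on $n$ pairs with $F(\mathcal E(\Omega_\alpha^{\otimes n}))=\frac{1+\alpha}{2}$. -/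

import Mathlib

open scoped Kronecker ComplexOrder

noncomputable section

/-- Computational basis of a register whose qubits are labelled by `ι`. -/
abbrev Reg (ι : Type) : Type := ι → Fin 2

/-- Computational basis of two qubits, the first held by Alice and the second by Bob. -/
abbrev TwoQubit : Type := Fin 2 × Fin 2

/-- A (mixed) quantum state in a fixed orthonormal basis. -/
structure IsDensityMatrix {ι : Type} [Fintype ι] (ρ : Matrix ι ι ℂ) : Prop where
  posSemidef : ρ.PosSemidef
  trace_eq_one : ρ.trace = 1

/-- The Bell vector `|Φ⁺⟩ = (|00⟩ + |11⟩) / √2`. -/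
def phiPlus : TwoQubit → ℂ :=
  fun p => if p = (0, 0) then ((1 / √2 : ℝ) : ℂ) else if p = (1, 1) then ((1 / √2 : ℝ) : ℂ) else 0

/-- The Bell vector `|Φ⁻⟩ = (|00⟩ - |11⟩) / √2`. -/
def phiMinus : TwoQubit → ℂ :=
  fun p => if p = (0, 0) then ((1 / √2 : ℝ) : ℂ) else if p = (1, 1) then -((1 / √2 : ℝ) : ℂ) else 0

/-- The rank-one operator `|ψ⟩⟨ψ|`. -/
def ketBra {ι : Type} (ψ : ι → ℂ) : Matrix ι ι ℂ := Matrix.vecMulVec ψ (star ψ)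

/-- The weakly entangled mixed state `Ω_α`. -/
def weaklyEntangled (α : ℝ) : Matrix TwoQubit TwoQubit ℂ :=
  (((1 + α) / 2 : ℝ) : ℂ) • ketBra phiPlus + (((1 - α) / 2 : ℝ) : ℂ) • ketBra phiMinus

/-- The real number `⟨Φ⁺| (U ⊗ V) ρ (U ⊗ V)† |Φ⁺⟩`. -/
def bellOverlap (ρ : Matrix TwoQubit TwoQubit ℂ)
    (W : Matrix.unitaryGroup (Fin 2) ℂ × Matrix.unitaryGroup (Fin 2) ℂ) : ℝ :=
  (star phiPlus ⬝ᵥ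
    ((((W.1 : Matrix (Fin 2) (Fin 2) ℂ) ⊗ₖ (W.2 : Matrix (Fin 2) (Fin 2) ℂ)) * ρ *
      ((W.1 : Matrix (Fin 2) (Fin 2) ℂ) ⊗ₖ (W.2 : Matrix (Fin 2) (Fin 2) ℂ)).conjTranspose).mulVec
        phiPlus)).re

/-- The fully entangled fraction: the maximum of `⟨Φ⁺| (U ⊗ V) ρ (U ⊗ V)† |Φ⁺⟩` over all
single-qubit unitaries `U`, `V`. -/
def fullyEntangledFraction (ρ : Matrix TwoQubit TwoQubit ℂ) : ℝ :=
  sSup (Set.range (bellOverlap ρ))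

/-- The supremum in `fullyEntangledFraction` is a maximum. -/
theorem isGreatest_fullyEntangledFraction (ρ : Matrix TwoQubit TwoQubit ℂ) :
    IsGreatest (Set.range (bellOverlap ρ)) (fullyEntangledFraction ρ) := by
  have hK : IsCompact (Matrix.unitaryGroup (Fin 2) ℂ : Set (Matrix (Fin 2) (Fin 2) ℂ)) := by
    have hc : IsCompact (Set.univ.pi fun _ : Fin 2 => Set.univ.pi fun _ : Fin 2 =>
        Metric.closedBall (0 : ℂ) 1) :=
      isCompact_univ_pi fun _ => isCompact_univ_pi fun _ => isCompact_closedBall _ _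
    refine hc.of_isClosed_subset ?_ ?_
    · have : (Matrix.unitaryGroup (Fin 2) ℂ : Set (Matrix (Fin 2) (Fin 2) ℂ)) =
          {A | A * star A = 1} := by
        ext A
        exact Matrix.mem_unitaryGroup_iff
      rw [this]
      exact isClosed_eq (by fun_prop) continuous_const
    · intro A hA i _ j _
      simpa using entry_norm_bound_of_unitary hA i j
  have : CompactSpace (Matrix.unitaryGroup (Fin 2) ℂ) := isCompact_iff_compactSpace.mp hK
  have hcont : Continuous (bellOverlap ρ) := by
    have h1 : Continuous fun W : Matrix.unitaryGroup (Fin 2) ℂ × Matrix.unitaryGroup (Fin 2) ℂ =>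
        ((W.1 : Matrix (Fin 2) (Fin 2) ℂ) ⊗ₖ (W.2 : Matrix (Fin 2) (Fin 2) ℂ)) := by
      refine continuous_matrix fun i j => ?_
      have ha : Continuous fun W : Matrix.unitaryGroup (Fin 2) ℂ × Matrix.unitaryGroup (Fin 2) ℂ =>
          (W.1 : Matrix (Fin 2) (Fin 2) ℂ) i.1 j.1 :=
        (continuous_subtype_val.comp continuous_fst).matrix_elem _ _
      have hb : Continuous fun W : Matrix.unitaryGroup (Fin 2) ℂ × Matrix.unitaryGroup (Fin 2) ℂ =>
          (W.2 : Matrix (Fin 2) (Fin 2) ℂ) i.2 j.2 :=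
        (continuous_subtype_val.comp continuous_snd).matrix_elem _ _
      exact ha.mul hb
    unfold bellOverlap
    exact Complex.continuous_re.comp (continuous_const.dotProduct
      (((h1.mul continuous_const).mul h1.matrix_conjTranspose).matrix_mulVec continuous_const))
  exact (isCompact_range hcont).isGreatest_sSup (Set.range_nonempty _)

/-- `ρ^{⊗n}` for a two-qubit operator `ρ`: the row index `(x, y)` collects Alice's `n` qubits in `x`
and Bob's `n` qubits in `y`. -/
def tensorPower (ρ : Matrix TwoQubit TwoQubit ℂ) (n : ℕ) :
    Matrix (Reg (Fin n) × Reg (Fin n)) (Reg (Fin n) × Reg (Fin n)) ℂ :=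
  fun p q => ∏ k, ρ (p.1 k, p.2 k) (q.1 k, q.2 k)

/-- `R ⊗ τA ⊗ τB`, for an operator `R` shared by Alice and Bob, with the ancilla registers regrouped
so that the row index is (all qubits of Alice, all qubits of Bob). -/
def withAncillas {n a b : ℕ}
    (R : Matrix (Reg (Fin n) × Reg (Fin n)) (Reg (Fin n) × Reg (Fin n)) ℂ)
    (τA : Matrix (Reg (Fin a)) (Reg (Fin a)) ℂ) (τB : Matrix (Reg (Fin b)) (Reg (Fin b)) ℂ) :
    Matrix (Reg (Fin n ⊕ Fin a) × Reg (Fin n ⊕ Fin b))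
      (Reg (Fin n ⊕ Fin a) × Reg (Fin n ⊕ Fin b)) ℂ :=
  let split : Reg (Fin n ⊕ Fin a) × Reg (Fin n ⊕ Fin b) →
      (Reg (Fin n) × Reg (Fin n)) × (Reg (Fin a) × Reg (Fin b)) :=
    fun p => ((p.1 ∘ Sum.inl, p.2 ∘ Sum.inl), (p.1 ∘ Sum.inr, p.2 ∘ Sum.inr))
  (R ⊗ₖ (τA ⊗ₖ τB)).submatrix split split

/-- Partial trace over every qubit except qubit `i` of Alice and qubit `j` of Bob. -/
def traceOutAllBut {ι κ : Type} [Fintype ι] [DecidableEq ι] [Fintype κ] [DecidableEq κ]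
    (i : ι) (j : κ) (M : Matrix (Reg ι × Reg κ) (Reg ι × Reg κ) ℂ) :
    Matrix TwoQubit TwoQubit ℂ :=
  fun p q => ∑ r : Reg {k : ι // k ≠ i}, ∑ s : Reg {k : κ // k ≠ j},
    M ((Equiv.funSplitAt i (Fin 2)).symm (p.1, r), (Equiv.funSplitAt j (Fin 2)).symm (p.2, s))
      ((Equiv.funSplitAt i (Fin 2)).symm (q.1, r), (Equiv.funSplitAt j (Fin 2)).symm (q.2, s))

/-- A protocol without communication and without shared randomness on `n` shared qubit pairs.
Alice and Bob add local ancilla qubits, apply local unitaries, and each keeps one qubit. -/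
structure LocalProtocol (n : ℕ) where
  /-- number of Alice's ancilla qubits -/
  ancA : ℕ
  /-- number of Bob's ancilla qubits -/
  ancB : ℕ
  /-- initial state of Alice's ancilla qubits -/
  stateA : Matrix (Reg (Fin ancA)) (Reg (Fin ancA)) ℂ
  /-- initial state of Bob's ancilla qubits -/
  stateB : Matrix (Reg (Fin ancB)) (Reg (Fin ancB)) ℂ
  isDensityA : IsDensityMatrix stateA
  isDensityB : IsDensityMatrix stateB
  /-- Alice's local unitary -/
  unitaryA : Matrix.unitaryGroup (Reg (Fin n ⊕ Fin ancA)) ℂ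
  /-- Bob's local unitary -/
  unitaryB : Matrix.unitaryGroup (Reg (Fin n ⊕ Fin ancB)) ℂ
  /-- the qubit that Alice keeps -/
  keepA : Fin n ⊕ Fin ancA
  /-- the qubit that Bob keeps -/
  keepB : Fin n ⊕ Fin ancB

/-- The two-qubit output of a local protocol on the input `R`. -/
def LocalProtocol.apply {n : ℕ} (P : LocalProtocol n)
    (R : Matrix (Reg (Fin n) × Reg (Fin n)) (Reg (Fin n) × Reg (Fin n)) ℂ) :
    Matrix TwoQubit TwoQubit ℂ :=
  let U := (P.unitaryA : Matrix (Reg (Fin n ⊕ Fin P.ancA)) (Reg (Fin n ⊕ Fin P.ancA)) ℂ) ⊗ₖ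
    (P.unitaryB : Matrix (Reg (Fin n ⊕ Fin P.ancB)) (Reg (Fin n ⊕ Fin P.ancB)) ℂ)
  traceOutAllBut P.keepA P.keepB (U * withAncillas R P.stateA P.stateB * U.conjTranspose)

/-- A probabilistic non-interactive entanglement-distillation protocol on `n` shared qubit pairs:
according to shared randomness, the parties carry out the local protocol number `l` with probability
`prob l`. -/
structure DistillationProtocol (n : ℕ) where
  /-- number of values of the shared randomness -/
  numOutcomes : ℕ
  prob : Fin numOutcomes → ℝ
  prob_nonneg : ∀ l, 0 ≤ prob l
  prob_sum : ∑ l, prob l = 1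
  protocol : Fin numOutcomes → LocalProtocol n

/-- The two-qubit output of a distillation protocol on the input `R`. -/
def DistillationProtocol.apply {n : ℕ} (E : DistillationProtocol n)
    (R : Matrix (Reg (Fin n) × Reg (Fin n)) (Reg (Fin n) × Reg (Fin n)) ℂ) :
    Matrix TwoQubit TwoQubit ℂ :=
  ∑ l, ((E.prob l : ℝ) : ℂ) • (E.protocol l).apply R

end

/-! Expanding in the computational basis, `Ω_α^{⊗n}` equals `2⁻ⁿ ∑ α^{d(x,y)} |x⟩⟨y| ⊗ |x⟩⟨y|`, with
`d` the Hamming distance. A local protocol acts on each term as a product of channels `A ⊗ B`, into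
which the unitaries of the fully entangled fraction are absorbed. The overlap with `Φ⁺` is half the
sum of the entrywise products of the two outputs, so by AM-GM it suffices to bound `∑ α^{d(x,y)}
‖A(|x⟩⟨y|)‖²` in Hilbert–Schmidt norm, and likewise for `B`.

Since `α^{d(x,y)} ≤ (1 - α) δ_{xy} + α`, two estimates suffice: output purity is at most 1
(`IsQuantumChannel.purity_le_one`), and the squared norm of the Choi matrix is at most `2ⁿ · 2`
(`IsQuantumChannel.choi_norm_sq_le`). Together they give `2ⁿ(1 + α)` per party, hence overlap at
most `(1 + α)/2`. Shared randomness only averages this bound, and keeping one pair attains it. -/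

open scoped Matrix

/-! ### Kraus form of the local operations. -/

/-- A completely positive trace-preserving map, given by Kraus operators. -/
def IsQuantumChannel {M N : Type} [Fintype M] [Fintype N] [DecidableEq N]
    (Φ : Matrix N N ℂ → Matrix M M ℂ) : Prop :=
  ∃ (κ : Type) (_ : Fintype κ) (K : κ → Matrix M N ℂ),
    ∑ k, (K k)ᴴ * K k = 1 ∧ ∀ X, Φ X = ∑ k, K k * X * (K k)ᴴ

theorem IsQuantumChannel.comp {L M N : Type} [Fintype L] [Fintype M] [Fintype N]
    [DecidableEq M] [DecidableEq N]
    {Ψ : Matrix M M ℂ → Matrix L L ℂ} {Φ : Matrix N N ℂ → Matrix M M ℂ}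
    (hΨ : IsQuantumChannel Ψ) (hΦ : IsQuantumChannel Φ) :
    IsQuantumChannel fun X => Ψ (Φ X) := by
  obtain ⟨κ, _, K, hK, hKΨ⟩ := hΨ
  obtain ⟨μ, _, J, hJ, hJΦ⟩ := hΦ
  refine ⟨κ × μ, inferInstance, fun k => K k.1 * J k.2, ?_, fun X => ?_⟩
  · rw [Fintype.sum_prod_type_right, ← hJ]
    refine Finset.sum_congr rfl fun j _ => ?_
    calc ∑ k, (K k * J j)ᴴ * (K k * J j) = ∑ k, (J j)ᴴ * ((K k)ᴴ * K k) * J j := by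
          simp only [Matrix.conjTranspose_mul, Matrix.mul_assoc]
      _ = (J j)ᴴ * J j := by
          rw [← Matrix.sum_mul, ← Matrix.mul_sum, hK, Matrix.mul_one]
  · simp only [hKΨ, hJΦ, Fintype.sum_prod_type, Matrix.conjTranspose_mul]
    refine Finset.sum_congr rfl fun k _ => ?_
    simp only [Matrix.mul_sum, Matrix.sum_mul, Matrix.mul_assoc]

theorem isQuantumChannel_unitary {N : Type} [Fintype N] [DecidableEq N]
    (U : Matrix.unitaryGroup N ℂ) :
    IsQuantumChannel fun X => (U : Matrix N N ℂ) * X * (U : Matrix N N ℂ)ᴴ := by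
  refine ⟨Unit, inferInstance, fun _ => U, ?_, fun X => by simp⟩
  simpa [Matrix.star_eq_conjTranspose] using Matrix.mem_unitaryGroup_iff'.mp U.2

/-- The operator `X ⊗ τ` on a joint register. -/
def adjoinState {ι κ : Type} (τ : Matrix (Reg κ) (Reg κ) ℂ) (X : Matrix (Reg ι) (Reg ι) ℂ) :
    Matrix (Reg (ι ⊕ κ)) (Reg (ι ⊕ κ)) ℂ :=
  fun p q => X (p ∘ Sum.inl) (q ∘ Sum.inl) * τ (p ∘ Sum.inr) (q ∘ Sum.inr)

theorem sum_reg_sum {ι κ : Type} [Fintype ι] [DecidableEq ι] [Fintype κ] [DecidableEq κ]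
    (f : Reg ι → Reg κ → ℂ) :
    ∑ p : Reg (ι ⊕ κ), f (p ∘ Sum.inl) (p ∘ Sum.inr) = ∑ x, ∑ e, f x e := by
  rw [← Fintype.sum_prod_type']
  exact Fintype.sum_equiv (Equiv.sumArrowEquivProdArrow ι κ (Fin 2)) _ _ fun _ => rfl

open scoped MatrixOrder Matrix.Norms.L2Operator in
theorem exists_eq_conjTranspose_mul_self {ι : Type} [Fintype ι] [DecidableEq ι]
    {τ : Matrix ι ι ℂ} (hτ : τ.PosSemidef) : ∃ S : Matrix ι ι ℂ, τ = Sᴴ * S :=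
  CStarAlgebra.nonneg_iff_eq_star_mul_self.mp hτ.nonneg

/-- With `τ = S†S`, the Kraus operators are `1 ⊗ S†|e⟩`; their completeness relation is `tr τ = 1`.
-/
theorem isQuantumChannel_adjoinState {ι κ : Type} [Fintype ι] [DecidableEq ι] [Fintype κ]
    [DecidableEq κ] {τ : Matrix (Reg κ) (Reg κ) ℂ} (hτ : IsDensityMatrix τ) :
    IsQuantumChannel (adjoinState (ι := ι) τ) := by
  obtain ⟨S, hS⟩ := exists_eq_conjTranspose_mul_self hτ.posSemidef
  refine ⟨Reg κ, inferInstance,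
    fun e => Matrix.of fun p x =>
      (if p ∘ Sum.inl = x then 1 else 0) * star (S e (p ∘ Sum.inr)), ?_, fun X => ?_⟩
  · have ht : ∑ e, ∑ f, S e f * star (S e f) = 1 := by
      rw [← hτ.trace_eq_one, hS, Matrix.trace, Finset.sum_comm]
      simp [Matrix.mul_apply, mul_comm]
    ext x y
    rw [Matrix.sum_apply]
    simp only [Matrix.mul_apply, Matrix.conjTranspose_apply, Matrix.of_apply]
    have h : ∀ e, ∑ p : Reg (ι ⊕ κ),
        star ((if p ∘ Sum.inl = x then 1 else 0) * star (S e (p ∘ Sum.inr))) *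
          ((if p ∘ Sum.inl = y then 1 else 0) * star (S e (p ∘ Sum.inr))) =
        if x = y then ∑ f, S e f * star (S e f) else 0 := by
      intro e
      rw [sum_reg_sum fun z f => star ((if z = x then 1 else 0) * star (S e f)) *
          ((if z = y then 1 else 0) * star (S e f))]
      rw [Finset.sum_eq_single x (by intro z _ hz; simp [hz]) (by simp)]
      by_cases hxy : x = y
      · subst hxy
        simp
      · simp [hxy]
    rw [Finset.sum_congr rfl fun e _ => h e]
    by_cases hxy : x = y
    · subst hxy
      simp only [if_true, ht, Matrix.one_apply_eq]
    · simp [hxy]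
  · ext p q
    rw [Matrix.sum_apply]
    simp only [adjoinState, Matrix.mul_apply, Matrix.conjTranspose_apply, Matrix.of_apply, hS, Finset.mul_sum]
    refine Finset.sum_congr rfl fun e _ => ?_
    simp only [ite_mul, mul_ite, one_mul, zero_mul, mul_zero, apply_ite star, star_zero,
      Finset.sum_ite_eq, Finset.mem_univ, if_true, star_star]
    ring

/-- Partial trace over every qubit except `i`. -/
def keepQubit {ι : Type} [Fintype ι] [DecidableEq ι] (i : ι) (M : Matrix (Reg ι) (Reg ι) ℂ) :
    Matrix (Fin 2) (Fin 2) ℂ :=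
  fun c d => ∑ r : Reg {k : ι // k ≠ i},
    M ((Equiv.funSplitAt i (Fin 2)).symm (c, r)) ((Equiv.funSplitAt i (Fin 2)).symm (d, r))

/-- The Kraus operators are the bras `⟨r|` on the discarded qubits. -/
theorem isQuantumChannel_keepQubit {ι : Type} [Fintype ι] [DecidableEq ι] (i : ι) :
    IsQuantumChannel (keepQubit i) := by
  refine ⟨Reg {k : ι // k ≠ i}, inferInstance,
    fun r => Matrix.of fun c p =>
      if (Equiv.funSplitAt i (Fin 2)).symm (c, r) = p then 1 else 0, ?_, fun X => ?_⟩
  · ext p q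
    rw [Matrix.sum_apply]
    simp only [Matrix.mul_apply, Matrix.conjTranspose_apply, Matrix.of_apply]
    rw [← Fintype.sum_prod_type_right' fun (c : Fin 2) (r : Reg {k : ι // k ≠ i}) =>
      star (if (Equiv.funSplitAt i (Fin 2)).symm (c, r) = p then (1 : ℂ) else 0) *
        (if (Equiv.funSplitAt i (Fin 2)).symm (c, r) = q then (1 : ℂ) else 0)]
    rw [(Equiv.funSplitAt i (Fin 2)).symm.sum_comp fun z =>
      star (if z = p then (1 : ℂ) else 0) * (if z = q then (1 : ℂ) else 0)]
    rw [Finset.sum_eq_single p (by intro z _ hz; simp [hz]) (by simp)]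
    simp [Matrix.one_apply]
  · ext c d
    rw [Matrix.sum_apply]
    simp [keepQubit, Matrix.mul_apply, Matrix.conjTranspose_apply, apply_ite (starRingEnd ℂ)]

/-! ### Hilbert–Schmidt bounds for channels. -/

theorem channel_single_apply {M N κ : Type} [Fintype M] [Fintype N] [DecidableEq N] [Fintype κ]
    (K : κ → Matrix M N ℂ) (x y : N) (c d : M) :
    (∑ k, K k * Matrix.single x y (1 : ℂ) * (K k)ᴴ : Matrix M M ℂ) c d = ∑ k, K k c x * star (K k d y) := by
  rw [Matrix.sum_apply]
  refine Finset.sum_congr rfl fun k _ => ?_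
  rw [Matrix.mul_apply, Finset.sum_eq_single y]
  · simp
  · intro z _ hz
    simp [Matrix.mul_single_apply_of_ne _ _ _ _ _ hz]
  · simp

theorem sum_norm_sq_kraus_column {M N κ : Type} [Fintype M] [Fintype N] [DecidableEq N] [Fintype κ]
    {K : κ → Matrix M N ℂ} (hK : ∑ k, (K k)ᴴ * K k = 1) (x : N) :
    ∑ c, ∑ k, ‖K k c x‖ ^ 2 = 1 := by
  have h := congrFun (congrFun hK x) x
  rw [Matrix.sum_apply, Matrix.one_apply_eq] at h
  simp only [Matrix.mul_apply, Matrix.conjTranspose_apply] at h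
  rw [Finset.sum_comm]
  have h2 : ∀ k c, star (K k c x) * K k c x = ((‖K k c x‖ ^ 2 : ℝ) : ℂ) := by
    intro k c
    simpa using Complex.conj_mul' (K k c x)
  simp only [h2] at h
  exact_mod_cast h

theorem norm_sq_sum_mul_star_le {κ : Type} [Fintype κ] (f g : κ → ℂ) :
    ‖∑ k, f k * star (g k)‖ ^ 2 ≤ (∑ k, ‖f k‖ ^ 2) * ∑ k, ‖g k‖ ^ 2 := by
  have h : ‖∑ k, f k * star (g k)‖ ≤ ∑ k, ‖f k‖ * ‖g k‖ :=
    (norm_sum_le _ _).trans (by simp)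
  exact (pow_le_pow_left₀ (norm_nonneg _) h 2).trans (Finset.sum_mul_sq_le_sq_mul_sq _ _ _)

/-- The output of a channel on a basis state has purity at most one. -/
theorem IsQuantumChannel.purity_le_one {M N : Type} [Fintype M] [Fintype N] [DecidableEq N]
    {Φ : Matrix N N ℂ → Matrix M M ℂ} (hΦ : IsQuantumChannel Φ) (x : N) :
    ∑ c, ∑ d, ‖Φ (Matrix.single x x 1) c d‖ ^ 2 ≤ 1 := by
  obtain ⟨κ, _, K, hK, hKΦ⟩ := hΦ
  calc ∑ c, ∑ d, ‖Φ (Matrix.single x x 1) c d‖ ^ 2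
      -- Cauchy–Schwarz over the Kraus index; the bound then factors into two output traces.
      ≤ ∑ c, ∑ d, (∑ k, ‖K k c x‖ ^ 2) * ∑ k, ‖K k d x‖ ^ 2 := by
        gcongr with c _ d _
        rw [hKΦ, channel_single_apply]
        exact norm_sq_sum_mul_star_le _ _
    _ = 1 := by
        rw [← Finset.sum_mul_sum, sum_norm_sq_kraus_column hK, one_mul]

/-- Bessel's inequality for the columns of the Stinespring isometry. -/
theorem kraus_bessel {M N κ : Type} [Fintype M] [DecidableEq M] [Fintype N] [DecidableEq N]
    [Fintype κ] {K : κ → Matrix M N ℂ} (hK : ∑ k, (K k)ᴴ * K k = 1) (d : M) (u : κ → ℂ) :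
    ∑ y, ‖∑ k, u k * star (K k d y)‖ ^ 2 ≤ ∑ k, ‖u k‖ ^ 2 := by
  let v : N → EuclideanSpace ℂ (M × κ) := fun y => WithLp.toLp 2 fun i => K i.2 i.1 y
  have hv : Orthonormal ℂ v := by
    rw [orthonormal_iff_ite]
    intro x y
    have h := congrFun (congrFun hK x) y
    rw [Matrix.sum_apply, Matrix.one_apply] at h
    rw [← h, PiLp.inner_apply, Fintype.sum_prod_type_right]
    simp [v, Matrix.mul_apply, mul_comm]
  -- Placing `u` in the output sector `d` makes its inner products with the columns the sums to be
  -- bounded.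
  let w : EuclideanSpace ℂ (M × κ) := WithLp.toLp 2 fun i => if i.1 = d then u i.2 else 0
  have hw : ‖w‖ ^ 2 = ∑ k, ‖u k‖ ^ 2 := by
    rw [EuclideanSpace.norm_sq_eq, Fintype.sum_prod_type_right]
    simp [w, apply_ite (norm : ℂ → ℝ), ite_pow]
  have hin : ∀ y, inner ℂ (v y) w = ∑ k, u k * star (K k d y) := by
    intro y
    rw [PiLp.inner_apply, Fintype.sum_prod_type_right]
    simp [v, w]
  have := hv.sum_inner_products_le (s := Finset.univ) w
  simpa only [hin, hw] using this

/-- The Choi matrix of a channel has squared Hilbert–Schmidt norm at most the product of the input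
and output dimensions. -/
theorem IsQuantumChannel.choi_norm_sq_le {M N : Type} [Fintype M] [DecidableEq M] [Fintype N]
    [DecidableEq N] {Φ : Matrix N N ℂ → Matrix M M ℂ} (hΦ : IsQuantumChannel Φ) :
    ∑ x, ∑ y, ∑ c, ∑ d, ‖Φ (Matrix.single x y 1) c d‖ ^ 2 ≤
      Fintype.card N * Fintype.card M := by
  obtain ⟨κ, _, K, hK, hKΦ⟩ := hΦ
  have hx : ∀ x, ∑ y, ∑ c, ∑ d, ‖Φ (Matrix.single x y 1) c d‖ ^ 2 ≤ Fintype.card M := by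
    intro x
    calc ∑ y, ∑ c, ∑ d, ‖Φ (Matrix.single x y 1) c d‖ ^ 2
        = ∑ c, ∑ d, ∑ y, ‖∑ k, K k c x * star (K k d y)‖ ^ 2 := by
          simp only [hKΦ, channel_single_apply]
          rw [Finset.sum_comm]
          exact Finset.sum_congr rfl fun c _ => Finset.sum_comm
      _ ≤ ∑ c, ∑ _d : M, ∑ k, ‖K k c x‖ ^ 2 := by
          -- Bessel removes the sum over `y`. Then the sum over `c` is a trace equal to 1, and only
          -- the sum over `d` costs a dimension.
          gcongr with c _ d _
          exact kraus_bessel hK d _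
      _ = Fintype.card M := by
          simp only [Finset.sum_const, Finset.card_univ, nsmul_eq_mul]
          rw [← Finset.mul_sum, sum_norm_sq_kraus_column hK, mul_one]
  calc _ ≤ ∑ _x : N, (Fintype.card M : ℝ) := Finset.sum_le_sum fun x _ => hx x
    _ = _ := by simp

/-! ### Channel bounds weighted by dephasing. -/

/-- The dephasing weight `α ^ d(x, y)`, with `d` the Hamming distance. -/
def dephasingWeight (α : ℝ) {n : ℕ} (x y : Reg (Fin n)) : ℝ :=
  ∏ k, if x k = y k then 1 else α

theorem dephasingWeight_nonneg {α : ℝ} (h0 : 0 ≤ α) {n : ℕ} (x y : Reg (Fin n)) :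
    0 ≤ dephasingWeight α x y :=
  Finset.prod_nonneg fun k _ => by split_ifs <;> simp [h0]

/-- Distinct strings differ somewhere, which gives one factor `α`; the other factors are at most 1.
-/
theorem dephasingWeight_le {α : ℝ} (h0 : 0 ≤ α) (h1 : α ≤ 1) {n : ℕ} (x y : Reg (Fin n)) :
    dephasingWeight α x y ≤ (if x = y then 1 - α else 0) + α := by
  by_cases hxy : x = y
  · simp [dephasingWeight, hxy]
  · obtain ⟨k, hk⟩ := Function.ne_iff.mp hxy
    rw [dephasingWeight, ← Finset.mul_prod_erase _ _ (Finset.mem_univ k), if_neg hk, if_neg hxy,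
      zero_add]
    refine mul_le_of_le_one_right h0 (Finset.prod_le_one ?_ ?_) <;> intro i _ <;>
      split_ifs <;> simp [h0, h1]

theorem IsQuantumChannel.sum_dephasingWeight_le {α : ℝ} (h0 : 0 ≤ α) (h1 : α ≤ 1) {n : ℕ}
    {Φ : Matrix (Reg (Fin n)) (Reg (Fin n)) ℂ → Matrix (Fin 2) (Fin 2) ℂ}
    (hΦ : IsQuantumChannel Φ) :
    ∑ x, ∑ y, dephasingWeight α x y * ∑ c, ∑ d, ‖Φ (Matrix.single x y 1) c d‖ ^ 2 ≤
      2 ^ n * (1 + α) := by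
  calc ∑ x, ∑ y, dephasingWeight α x y * ∑ c, ∑ d, ‖Φ (Matrix.single x y 1) c d‖ ^ 2
      ≤ ∑ x, ∑ y, ((if x = y then 1 - α else 0) + α) *
          ∑ c, ∑ d, ‖Φ (Matrix.single x y 1) c d‖ ^ 2 := by
        gcongr with x _ y _
        exact dephasingWeight_le h0 h1 x y
    _ = (1 - α) * ∑ x, ∑ c, ∑ d, ‖Φ (Matrix.single x x 1) c d‖ ^ 2 +
          α * ∑ x, ∑ y, ∑ c, ∑ d, ‖Φ (Matrix.single x y 1) c d‖ ^ 2 := by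
        simp only [add_mul, ite_mul, zero_mul, Finset.sum_add_distrib, Finset.sum_ite_eq,
          Finset.mem_univ, if_true]
        simp only [← Finset.mul_sum]
    _ ≤ (1 - α) * ∑ _x : Reg (Fin n), 1 + α * (Fintype.card (Reg (Fin n)) * Fintype.card (Fin 2)) := by
        refine add_le_add (mul_le_mul_of_nonneg_left ?_ (by linarith))
          (mul_le_mul_of_nonneg_left hΦ.choi_norm_sq_le h0)
        exact Finset.sum_le_sum fun x _ => hΦ.purity_le_one x
    _ = 2 ^ n * (1 + α) := by
        simp
        ring

/-! ### Expansion of the input and factorization of protocols. -/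

theorem weaklyEntangled_apply (α : ℝ) (p q : TwoQubit) :
    weaklyEntangled α p q =
      if p.1 = p.2 ∧ q.1 = q.2 then (((if p.1 = q.1 then 1 else α) / 2 : ℝ) : ℂ) else 0 := by
  have h2 : ((√2 : ℝ) : ℂ)⁻¹ * ((√2 : ℝ) : ℂ)⁻¹ = 1 / 2 := by
    rw [← mul_inv, ← Complex.ofReal_mul, Real.mul_self_sqrt (by norm_num)]
    norm_num
  obtain ⟨a, b⟩ := p
  obtain ⟨c, d⟩ := q
  fin_cases a <;> fin_cases b <;> fin_cases c <;> fin_cases d <;>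
    simp [weaklyEntangled, ketBra, phiPlus, phiMinus, Matrix.vecMulVec_apply, h2] <;> ring

theorem tensorPower_weaklyEntangled (α : ℝ) (n : ℕ) :
    tensorPower (weaklyEntangled α) n = ∑ x, ∑ y, ((dephasingWeight α x y / 2 ^ n : ℝ) : ℂ) •
      (Matrix.single x y 1 ⊗ₖ Matrix.single x y 1) := by
  ext ⟨p, p'⟩ ⟨q, q'⟩
  simp only [Matrix.sum_apply, Matrix.smul_apply, Matrix.kroneckerMap_apply, Matrix.single_apply,
    smul_eq_mul]
  rw [Finset.sum_eq_single p (by intro x _ hx; simp [hx]) (by simp),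
    Finset.sum_eq_single q (by intro x _ hx; simp [hx]) (by simp)]
  simp only [tensorPower, weaklyEntangled_apply]
  by_cases h : p = p' ∧ q = q'
  · obtain ⟨rfl, rfl⟩ := h
    simp [dephasingWeight, Finset.prod_div_distrib]
  · have : ∃ k, ¬ (p k = p' k ∧ q k = q' k) := by
      by_contra! hk
      exact h ⟨funext fun k => (hk k).1, funext fun k => (hk k).2⟩
    obtain ⟨k, hk⟩ := this
    rw [Finset.prod_eq_zero (Finset.mem_univ k) (by rw [if_neg hk])]
    by_cases hp : p = p'
    · have hq : ¬ q = q' := fun hq => h ⟨hp, hq⟩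
      simp [hq]
    · simp [hp]

theorem withAncillas_kronecker {n a b : ℕ} (X Y : Matrix (Reg (Fin n)) (Reg (Fin n)) ℂ)
    (τA : Matrix (Reg (Fin a)) (Reg (Fin a)) ℂ) (τB : Matrix (Reg (Fin b)) (Reg (Fin b)) ℂ) :
    withAncillas (X ⊗ₖ Y) τA τB = adjoinState τA X ⊗ₖ adjoinState τB Y := by
  ext p q
  simp only [withAncillas, adjoinState, Matrix.submatrix_apply, Matrix.kroneckerMap_apply]
  ring

theorem traceOutAllBut_kronecker {ι κ : Type} [Fintype ι] [DecidableEq ι] [Fintype κ]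
    [DecidableEq κ] (i : ι) (j : κ) (X : Matrix (Reg ι) (Reg ι) ℂ) (Y : Matrix (Reg κ) (Reg κ) ℂ) :
    traceOutAllBut i j (X ⊗ₖ Y) = keepQubit i X ⊗ₖ keepQubit j Y := by
  ext p q
  simp only [traceOutAllBut, keepQubit, Matrix.kroneckerMap_apply, Finset.sum_mul_sum]

/-- Alice's part of a local protocol, as a map from `n` qubits to one. -/
def LocalProtocol.channelA {n : ℕ} (P : LocalProtocol n)
    (X : Matrix (Reg (Fin n)) (Reg (Fin n)) ℂ) : Matrix (Fin 2) (Fin 2) ℂ :=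
  keepQubit P.keepA (P.unitaryA.1 * adjoinState P.stateA X * P.unitaryA.1ᴴ)

/-- Bob's part of a local protocol, as a map from `n` qubits to one. -/
def LocalProtocol.channelB {n : ℕ} (P : LocalProtocol n)
    (X : Matrix (Reg (Fin n)) (Reg (Fin n)) ℂ) : Matrix (Fin 2) (Fin 2) ℂ :=
  keepQubit P.keepB (P.unitaryB.1 * adjoinState P.stateB X * P.unitaryB.1ᴴ)

theorem LocalProtocol.isQuantumChannel_channelA {n : ℕ} (P : LocalProtocol n) :
    IsQuantumChannel P.channelA :=
  (isQuantumChannel_keepQubit P.keepA).comp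
    ((isQuantumChannel_unitary P.unitaryA).comp (isQuantumChannel_adjoinState P.isDensityA))

theorem LocalProtocol.isQuantumChannel_channelB {n : ℕ} (P : LocalProtocol n) :
    IsQuantumChannel P.channelB :=
  (isQuantumChannel_keepQubit P.keepB).comp
    ((isQuantumChannel_unitary P.unitaryB).comp (isQuantumChannel_adjoinState P.isDensityB))

theorem LocalProtocol.apply_kronecker {n : ℕ} (P : LocalProtocol n)
    (X Y : Matrix (Reg (Fin n)) (Reg (Fin n)) ℂ) :
    P.apply (X ⊗ₖ Y) = P.channelA X ⊗ₖ P.channelB Y := by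
  simp only [LocalProtocol.apply, withAncillas_kronecker, Matrix.conjTranspose_kronecker,
    ← Matrix.mul_kronecker_mul, traceOutAllBut_kronecker]
  rfl

theorem LocalProtocol.apply_add {n : ℕ} (P : LocalProtocol n)
    (R S : Matrix (Reg (Fin n) × Reg (Fin n)) (Reg (Fin n) × Reg (Fin n)) ℂ) :
    P.apply (R + S) = P.apply R + P.apply S := by
  have h : withAncillas (R + S) P.stateA P.stateB =
      withAncillas R P.stateA P.stateB + withAncillas S P.stateA P.stateB := by
    ext p q
    simp [withAncillas, add_mul]
  ext p q
  simp [LocalProtocol.apply, h, mul_add, add_mul, traceOutAllBut, Finset.sum_add_distrib]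

theorem LocalProtocol.apply_smul {n : ℕ} (P : LocalProtocol n) (z : ℂ)
    (R : Matrix (Reg (Fin n) × Reg (Fin n)) (Reg (Fin n) × Reg (Fin n)) ℂ) :
    P.apply (z • R) = z • P.apply R := by
  have h : withAncillas (z • R) P.stateA P.stateB = z • withAncillas R P.stateA P.stateB := by
    ext p q
    simp [withAncillas, mul_assoc]
  ext p q
  simp [LocalProtocol.apply, h, traceOutAllBut, Finset.mul_sum]

theorem LocalProtocol.apply_sum_smul {n : ℕ} (P : LocalProtocol n) {ι : Type} (s : Finset ι)
    (z : ι → ℂ) (R : ι → Matrix (Reg (Fin n) × Reg (Fin n)) (Reg (Fin n) × Reg (Fin n)) ℂ) :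
    P.apply (∑ i ∈ s, z i • R i) = ∑ i ∈ s, z i • P.apply (R i) := by
  let L : Matrix (Reg (Fin n) × Reg (Fin n)) (Reg (Fin n) × Reg (Fin n)) ℂ →ₗ[ℂ]
      Matrix TwoQubit TwoQubit ℂ :=
    { toFun := P.apply, map_add' := P.apply_add, map_smul' := P.apply_smul }
  have h := map_sum L (fun i => z i • R i) s
  simp only [map_smul] at h
  exact h

/-! ### Bell overlap and the upper bound. -/

theorem bellOverlap_sum_smul {ι : Type} (s : Finset ι) (z : ι → ℝ)
    (ρ : ι → Matrix TwoQubit TwoQubit ℂ)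
    (W : Matrix.unitaryGroup (Fin 2) ℂ × Matrix.unitaryGroup (Fin 2) ℂ) :
    bellOverlap (∑ i ∈ s, (z i : ℂ) • ρ i) W = ∑ i ∈ s, z i * bellOverlap (ρ i) W := by
  simp only [bellOverlap, Finset.mul_sum, Finset.sum_mul, Matrix.sum_mulVec, dotProduct_sum,
    Complex.re_sum, Matrix.mul_smul, Matrix.smul_mul, Matrix.smul_mulVec, dotProduct_smul,
    smul_eq_mul, Complex.re_ofReal_mul]

theorem star_phiPlus_dotProduct_mulVec (M : Matrix TwoQubit TwoQubit ℂ) :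
    star phiPlus ⬝ᵥ M.mulVec phiPlus = (∑ c, ∑ d, M (c, c) (d, d)) / 2 := by
  have h2 : ((√2 : ℝ) : ℂ)⁻¹ * ((√2 : ℝ) : ℂ)⁻¹ = 1 / 2 := by
    rw [← mul_inv, ← Complex.ofReal_mul, Real.mul_self_sqrt (by norm_num)]
    norm_num
  simp [dotProduct, Matrix.mulVec, phiPlus, Fintype.sum_prod_type, Fin.sum_univ_two]
  linear_combination (M (0, 0) (0, 0) + M (0, 0) (1, 1) + M (1, 1) (0, 0) + M (1, 1) (1, 1)) * h2

theorem bellOverlap_kronecker (X Y : Matrix (Fin 2) (Fin 2) ℂ)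
    (W : Matrix.unitaryGroup (Fin 2) ℂ × Matrix.unitaryGroup (Fin 2) ℂ) :
    bellOverlap (X ⊗ₖ Y) W =
      (∑ c, ∑ d, ((W.1.1 * X * W.1.1ᴴ) c d * (W.2.1 * Y * W.2.1ᴴ) c d).re) / 2 := by
  rw [bellOverlap, Matrix.conjTranspose_kronecker, ← Matrix.mul_kronecker_mul,
    ← Matrix.mul_kronecker_mul, star_phiPlus_dotProduct_mulVec]
  simp only [Matrix.kroneckerMap_apply, ← Complex.re_sum]
  exact Complex.div_ofNat_re _ 2

theorem re_mul_le_norm_sq_add_norm_sq (z w : ℂ) : (z * w).re ≤ (‖z‖ ^ 2 + ‖w‖ ^ 2) / 2 := by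
  have h := Complex.re_le_norm (z * w)
  rw [norm_mul] at h
  nlinarith [sq_nonneg (‖z‖ - ‖w‖)]

theorem LocalProtocol.bellOverlap_apply_le {α : ℝ} (h0 : 0 ≤ α) (h1 : α ≤ 1) {n : ℕ}
    (P : LocalProtocol n) (W : Matrix.unitaryGroup (Fin 2) ℂ × Matrix.unitaryGroup (Fin 2) ℂ) :
    bellOverlap (P.apply (tensorPower (weaklyEntangled α) n)) W ≤ (1 + α) / 2 := by
  -- Composing with `W` again gives channels, so the weighted bound covers all choices of `W` at
  -- once.
  have hA := ((isQuantumChannel_unitary W.1).comp P.isQuantumChannel_channelA).sum_dephasingWeight_le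
    h0 h1
  have hB := ((isQuantumChannel_unitary W.2).comp P.isQuantumChannel_channelB).sum_dephasingWeight_le
    h0 h1
  set ΦA := fun X => W.1.1 * P.channelA X * W.1.1ᴴ with hΦA
  set ΦB := fun X => W.2.1 * P.channelB X * W.2.1ᴴ with hΦB
  have key : ∀ x y : Reg (Fin n), bellOverlap
      (P.apply (Matrix.single x y 1 ⊗ₖ Matrix.single x y 1)) W ≤
      ((∑ c, ∑ d, ‖ΦA (Matrix.single x y 1) c d‖ ^ 2) +
        ∑ c, ∑ d, ‖ΦB (Matrix.single x y 1) c d‖ ^ 2) / 4 := by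
    intro x y
    rw [P.apply_kronecker, bellOverlap_kronecker]
    have : ∑ c, ∑ d, (ΦA (Matrix.single x y 1) c d * ΦB (Matrix.single x y 1) c d).re ≤
        ∑ c, ∑ d, (‖ΦA (Matrix.single x y 1) c d‖ ^ 2 +
          ‖ΦB (Matrix.single x y 1) c d‖ ^ 2) / 2 :=
      Finset.sum_le_sum fun c _ => Finset.sum_le_sum fun d _ => re_mul_le_norm_sq_add_norm_sq _ _
    simp only [← Finset.sum_div, Finset.sum_add_distrib] at this
    simp only [hΦA, hΦB] at this ⊢
    linarith
  have h2n : (0 : ℝ) < 2 ^ n := by positivity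
  rw [tensorPower_weaklyEntangled, ← Fintype.sum_prod_type'
    (f := fun x y : Reg (Fin n) => ((dephasingWeight α x y / 2 ^ n : ℝ) : ℂ) •
      (Matrix.single x y (1 : ℂ) ⊗ₖ Matrix.single x y (1 : ℂ))),
    P.apply_sum_smul, bellOverlap_sum_smul]
  calc _ ≤ ∑ i : Reg (Fin n) × Reg (Fin n), dephasingWeight α i.1 i.2 / 2 ^ n *
        (((∑ c, ∑ d, ‖ΦA (Matrix.single i.1 i.2 1) c d‖ ^ 2) +
        ∑ c, ∑ d, ‖ΦB (Matrix.single i.1 i.2 1) c d‖ ^ 2) / 4) := by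
        refine Finset.sum_le_sum fun i _ => mul_le_mul_of_nonneg_left (key i.1 i.2) ?_
        exact div_nonneg (dephasingWeight_nonneg h0 _ _) h2n.le
    _ = ((∑ x, ∑ y, dephasingWeight α x y * ∑ c, ∑ d, ‖ΦA (Matrix.single x y 1) c d‖ ^ 2) +
          ∑ x, ∑ y, dephasingWeight α x y * ∑ c, ∑ d, ‖ΦB (Matrix.single x y 1) c d‖ ^ 2) /
          (4 * 2 ^ n) := by
        rw [Fintype.sum_prod_type, ← Finset.sum_add_distrib, Finset.sum_div]
        refine Finset.sum_congr rfl fun x _ => ?_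
        rw [← Finset.sum_add_distrib, Finset.sum_div]
        refine Finset.sum_congr rfl fun y _ => ?_
        field_simp
    _ ≤ (1 + α) / 2 := by
        rw [div_le_iff₀ (by positivity)]
        linarith

theorem fullyEntangledFraction_apply_le {α : ℝ} (h0 : 0 ≤ α) (h1 : α ≤ 1) {n : ℕ}
    (E : DistillationProtocol n) :
    fullyEntangledFraction (E.apply (tensorPower (weaklyEntangled α) n)) ≤ (1 + α) / 2 := by
  -- At a fixed maximizer `W` the overlap is linear in the state, so it averages over the shared
  -- randomness.
  obtain ⟨W, hW⟩ := (isGreatest_fullyEntangledFraction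
    (E.apply (tensorPower (weaklyEntangled α) n))).1
  rw [← hW, DistillationProtocol.apply, bellOverlap_sum_smul]
  calc _ ≤ ∑ l, E.prob l * ((1 + α) / 2) := Finset.sum_le_sum fun l _ =>
        mul_le_mul_of_nonneg_left ((E.protocol l).bellOverlap_apply_le h0 h1 W) (E.prob_nonneg l)
    _ = (1 + α) / 2 := by rw [← Finset.sum_mul, E.prob_sum, one_mul]

/-! ### Tightness. -/

/-- The local protocol that keeps the pair `i` and discards the others. -/
def keepPair {n : ℕ} (i : Fin n) : LocalProtocol n where
  ancA := 0
  ancB := 0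
  -- A register of no qubits has a single basis state, so the identity has trace 1.
  stateA := 1
  stateB := 1
  isDensityA := ⟨Matrix.PosSemidef.one, by simp⟩
  isDensityB := ⟨Matrix.PosSemidef.one, by simp⟩
  unitaryA := 1
  unitaryB := 1
  keepA := Sum.inl i
  keepB := Sum.inl i

theorem keepPair_apply {n : ℕ} (i : Fin n) (ρ : Matrix TwoQubit TwoQubit ℂ) (hρ : ρ.trace = 1) :
    (keepPair i).apply (tensorPower ρ n) = ρ := by
  ext ⟨a, b⟩ ⟨c, d⟩
  have hterm : ∀ p q : Reg (Fin n ⊕ Fin 0) × Reg (Fin n ⊕ Fin 0),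
      withAncillas (tensorPower ρ n) (1 : Matrix (Reg (Fin 0)) (Reg (Fin 0)) ℂ)
        (1 : Matrix (Reg (Fin 0)) (Reg (Fin 0)) ℂ) p q =
      ∏ k, ρ (p.1 k, p.2 k) (q.1 k, q.2 k) := by
    intro p q
    simp only [withAncillas, tensorPower, Matrix.submatrix_apply, Matrix.kroneckerMap_apply,
      Subsingleton.elim (q.1 ∘ Sum.inr) (p.1 ∘ Sum.inr),
      Subsingleton.elim (q.2 ∘ Sum.inr) (p.2 ∘ Sum.inr), Matrix.one_apply_eq, mul_one,
      Fintype.prod_sum_type, Finset.univ_eq_empty, Finset.prod_empty, Function.comp_apply]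
  -- The sum over the discarded qubits factors into one `tr ρ` per discarded pair.
  have hsum : ∑ r : Reg {k : Fin n ⊕ Fin 0 // k ≠ Sum.inl i},
      ∑ s : Reg {k : Fin n ⊕ Fin 0 // k ≠ Sum.inl i}, ∏ k, ρ (r k, s k) (r k, s k) = 1 := by
    have h : ∀ r : Reg {k : Fin n ⊕ Fin 0 // k ≠ Sum.inl i},
        ∑ s : Reg {k : Fin n ⊕ Fin 0 // k ≠ Sum.inl i}, ∏ k, ρ (r k, s k) (r k, s k) =
        ∏ k, ∑ y, ρ (r k, y) (r k, y) := fun r =>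
      (Fintype.prod_sum fun k y => ρ (r k, y) (r k, y)).symm
    rw [Finset.sum_congr rfl fun r _ => h r, ← Fintype.prod_sum fun _ x => ∑ y, ρ (x, y) (x, y)]
    rw [Matrix.trace, Fintype.sum_prod_type] at hρ
    exact Finset.prod_eq_one fun _ _ => hρ
  have happ : (keepPair i).apply (tensorPower ρ n) = traceOutAllBut (Sum.inl i) (Sum.inl i)
      (withAncillas (tensorPower ρ n) (1 : Matrix (Reg (Fin 0)) (Reg (Fin 0)) ℂ)
        (1 : Matrix (Reg (Fin 0)) (Reg (Fin 0)) ℂ)) := by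
    change traceOutAllBut (Sum.inl i) (Sum.inl i)
      (((1 : Matrix (Reg (Fin n ⊕ Fin 0)) (Reg (Fin n ⊕ Fin 0)) ℂ) ⊗ₖ
          (1 : Matrix (Reg (Fin n ⊕ Fin 0)) (Reg (Fin n ⊕ Fin 0)) ℂ)) *
        withAncillas (tensorPower ρ n) (1 : Matrix (Reg (Fin 0)) (Reg (Fin 0)) ℂ)
          (1 : Matrix (Reg (Fin 0)) (Reg (Fin 0)) ℂ) *
        ((1 : Matrix (Reg (Fin n ⊕ Fin 0)) (Reg (Fin n ⊕ Fin 0)) ℂ) ⊗ₖ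
          (1 : Matrix (Reg (Fin n ⊕ Fin 0)) (Reg (Fin n ⊕ Fin 0)) ℂ))ᴴ) = _
    rw [Matrix.one_kronecker_one, Matrix.conjTranspose_one, Matrix.one_mul, Matrix.mul_one]
  rw [happ, traceOutAllBut]
  calc _ = ∑ r : Reg {k : Fin n ⊕ Fin 0 // k ≠ Sum.inl i},
      ∑ s : Reg {k : Fin n ⊕ Fin 0 // k ≠ Sum.inl i},
        ρ (a, b) (c, d) * ∏ k, ρ (r k, s k) (r k, s k) := by
        refine Finset.sum_congr rfl fun r _ => Finset.sum_congr rfl fun s _ => ?_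
        rw [hterm, Fintype.prod_eq_mul_prod_subtype_ne _ (Sum.inl i)]
        congr 1
        · simp [Equiv.funSplitAt]
        · refine Finset.prod_congr rfl fun k _ => ?_
          simp [Equiv.funSplitAt, k.2]
    _ = ρ (a, b) (c, d) := by
        simp only [← Finset.mul_sum, hsum, mul_one]

theorem trace_weaklyEntangled (α : ℝ) : (weaklyEntangled α).trace = 1 := by
  simp [Matrix.trace, weaklyEntangled_apply, Fintype.sum_prod_type]

theorem bellOverlap_weaklyEntangled (α : ℝ) :
    bellOverlap (weaklyEntangled α) 1 = (1 + α) / 2 := by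
  rw [bellOverlap, star_phiPlus_dotProduct_mulVec]
  simp [weaklyEntangled_apply]
  ring

/-- The distillation protocol without randomness that keeps the pair `i`. -/
def keepPairProtocol {n : ℕ} (i : Fin n) : DistillationProtocol n where
  numOutcomes := 1
  prob := fun _ => 1
  prob_nonneg := fun _ => zero_le_one
  prob_sum := by simp
  protocol := fun _ => keepPair i

theorem mainTheorem2 (α : ℝ) (hα0 : 0 ≤ α) (hα1 : α ≤ 1) :
    (∀ (n : ℕ) (E : DistillationProtocol n),
      fullyEntangledFraction (E.apply (tensorPower (weaklyEntangled α) n)) ≤ (1 + α) / 2) ∧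
    (∀ n : ℕ, 1 ≤ n → ∃ E : DistillationProtocol n,
      fullyEntangledFraction (E.apply (tensorPower (weaklyEntangled α) n)) = (1 + α) / 2) := by
  refine ⟨fun n E => fullyEntangledFraction_apply_le hα0 hα1 E, fun n hn => ?_⟩
  refine ⟨keepPairProtocol ⟨0, hn⟩, le_antisymm (fullyEntangledFraction_apply_le hα0 hα1 _) ?_⟩
  have h : (keepPairProtocol ⟨0, hn⟩).apply (tensorPower (weaklyEntangled α) n) =
      weaklyEntangled α := by
    change ∑ _l : Fin 1, ((1 : ℝ) : ℂ) • (keepPair _).apply _ = _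
    rw [keepPair_apply _ _ (trace_weaklyEntangled α)]
    simp
  rw [h, ← bellOverlap_weaklyEntangled]
  exact (isGreatest_fullyEntangledFraction _).2 ⟨1, rfl⟩
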